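/- Let $\mathbb H^3$ be hyperbolic $3$-space. For $\lambda>0$ and $\tau\in\mathbb R$ let $\varphi_{\lambda+i\tau}$ be the loxodromic isometry of $\mathbb H^3$ that translates a fixed bi-infinite geodesic $\sigma$ along itself by distance $\lambda$ and rotates about it by angle $\tau$, and let $N=\mathbb H^3/\langle\varphi_{\lambda+i\tau}\rangle$ be the nonsingular model solid torus whose core geodesic $\Sigma$ (the image of $\sigma$) has complex length $\lambda+i\tau$. For $x\in N$ let $\operatorname{injrad}(x)$ be the supremal $r$ such that the open metric $r$-ball about $x$ is isometric (as a Riemannian manifold) to a ball of radius $r$ in $\mathbb H^3$. For $\epsilon>0$ put $N^{<\epsilon}=\{x\in N:\operatorname{injrad}(x)<\epsilon/2\}$ and $N^{\le\epsilon}=\{x\in N:\operatorname{injrad}(x)\le\epsilon/2\}$. When $N^{<\epsilon}\neq\emptyset$, the boundary $T^\epsilon=\partial N^{\le\epsilon}$ is an equidistant torus, consisting of all points of $N$ at one distance from $\Sigma$; this distance is the tube radius $r(\epsilon)$. **Proposition.** Let $n\ge 4$ be an integer and let $N$ be the nonsingular model solid torus whose core geodesic has complex length $$\lambda+i\tau=\frac1{n^2}+i\,\frac{2\pi}{n}.$$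 Then, for every $\epsilon$ with $1.016/n\le\epsilon\le 0.3$, the set $N^{<\epsilon}$ is nonempty (so that $r(\epsilon)$ is defined, $T^\epsilon$ being the nonempty set of all points at distance $r(\epsilon)$ from $\Sigma$), and $$\cosh r(\epsilon)=\sqrt{\frac{\cosh\epsilon-1}{\cosh\sqrt\lambda-1}}\ \in\ \left(\frac{\epsilon}{\sqrt\lambda},\ 1.004\,\frac{\epsilon}{\sqrt\lambda}\right).$$ -/

import Mathlib

/-- Hyperbolic `3`-space in the upper half-space model: the points `(z, t)` of `ℂ × ℝ` with
`t > 0`, carrying the Riemannian metric `(|dz|² + dt²) / t²`. -/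
@[ext]
structure HypSpace where
  z : ℂ
  t : ℝ
  t_pos : 0 < t

namespace HypSpace

/-- The point of Euclidean `3`-space with the same coordinates. -/
noncomputable def toEuclid (p : HypSpace) : WithLp 2 (ℂ × ℝ) := WithLp.toLp 2 (p.z, p.t)

/-- The mirror image in the boundary plane (used only for the triangle inequality). -/
noncomputable def mirror (p : HypSpace) : WithLp 2 (ℂ × ℝ) := WithLp.toLp 2 (p.z, -p.t)

/-- The hyperbolic distance: `sinh (d / 2) = |p - q|_{Euclid} / (2 √(t_p t_q))`, equivalently
`cosh d = 1 + |p - q|²_{Euclid} / (2 t_p t_q)` (proved below as `cosh_dist`). -/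
noncomputable instance : Dist HypSpace :=
  ⟨fun p q => 2 * Real.arsinh (dist p.toEuclid q.toEuclid / (2 * √(p.t * q.t)))⟩

theorem dist_eq (p q : HypSpace) :
    dist p q = 2 * Real.arsinh (dist p.toEuclid q.toEuclid / (2 * √(p.t * q.t))) := rfl

theorem dist_toEuclid_sq (p q : HypSpace) :
    dist p.toEuclid q.toEuclid ^ 2 = ‖p.z - q.z‖ ^ 2 + (p.t - q.t) ^ 2 := by
  rw [WithLp.prod_dist_eq_of_L2, Real.sq_sqrt (by positivity)]
  simp [toEuclid, Complex.dist_eq, Real.dist_eq, sq_abs]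

theorem dist_toEuclid_mirror_sq (p q : HypSpace) :
    dist p.toEuclid q.mirror ^ 2 = ‖p.z - q.z‖ ^ 2 + (p.t + q.t) ^ 2 := by
  rw [WithLp.prod_dist_eq_of_L2, Real.sq_sqrt (by positivity)]
  simp [toEuclid, mirror, Complex.dist_eq, Real.dist_eq, sq_abs]

theorem dist_self_mirror (p : HypSpace) : dist p.toEuclid p.mirror = 2 * p.t := by
  have h := dist_toEuclid_mirror_sq p p
  have hp := p.t_pos
  rw [sub_self, norm_zero] at h
  have : dist p.toEuclid p.mirror ^ 2 = (2 * p.t) ^ 2 := by rw [h]; ring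
  exact (sq_eq_sq₀ dist_nonneg (by positivity)).1 this

theorem dist_mirror_comm (p q : HypSpace) :
    dist p.toEuclid q.mirror = dist q.toEuclid p.mirror := by
  rw [← sq_eq_sq₀ dist_nonneg dist_nonneg, dist_toEuclid_mirror_sq, dist_toEuclid_mirror_sq,
    norm_sub_rev, add_comm p.t]

theorem sinh_half_dist (p q : HypSpace) :
    Real.sinh (dist p q / 2) = dist p.toEuclid q.toEuclid / (2 * √(p.t * q.t)) := by
  rw [dist_eq, mul_div_cancel_left₀ _ (two_ne_zero' ℝ), Real.sinh_arsinh]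

theorem cosh_half_dist (p q : HypSpace) :
    Real.cosh (dist p q / 2) = dist p.toEuclid q.mirror / (2 * √(p.t * q.t)) := by
  have hp := p.t_pos
  have hq := q.t_pos
  have hpq := mul_pos hp hq
  rw [← sq_eq_sq₀ (Real.cosh_pos _).le (by positivity), Real.cosh_sq', sinh_half_dist, div_pow,
    div_pow, mul_pow, Real.sq_sqrt hpq.le, dist_toEuclid_sq, dist_toEuclid_mirror_sq]
  field_simp
  ring

theorem cosh_dist (p q : HypSpace) :
    Real.cosh (dist p q) = 1 + (‖p.z - q.z‖ ^ 2 + (p.t - q.t) ^ 2) / (2 * p.t * q.t) := by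
  have hp := p.t_pos
  have hq := q.t_pos
  have h : dist p q = 2 * (dist p q / 2) := by ring
  rw [h, Real.cosh_two_mul, Real.cosh_sq', sinh_half_dist, div_pow, mul_pow,
    Real.sq_sqrt (mul_pos hp hq).le, dist_toEuclid_sq]
  field_simp
  ring

theorem dist_triangle' (a b c : HypSpace) : dist a c ≤ dist a b + dist b c := by
  have ha := a.t_pos
  have hb := b.t_pos
  have hc := c.t_pos
  have key := EuclideanGeometry.mul_dist_le_mul_dist_add_mul_dist
    a.toEuclid b.toEuclid c.toEuclid b.mirror
  rw [dist_self_mirror] at key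
  have e : dist a c / 2 ≤ dist a b / 2 + dist b c / 2 := by
    rw [← Real.sinh_le_sinh, Real.sinh_add, sinh_half_dist, sinh_half_dist, sinh_half_dist,
      cosh_half_dist, cosh_half_dist, dist_mirror_comm b c, Real.sqrt_mul ha.le,
      Real.sqrt_mul ha.le, Real.sqrt_mul hb.le]
    have sa := Real.sqrt_pos.2 ha
    have sb := Real.sqrt_pos.2 hb
    have sc := Real.sqrt_pos.2 hc
    have hbb : √b.t * √b.t = b.t := Real.mul_self_sqrt hb.le
    set A := √a.t
    set B := √b.t
    set C := √c.t
    rw [← hbb] at key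
    rw [div_mul_div_comm, div_mul_div_comm, div_add_div _ _ (by positivity) (by positivity),
      div_le_div_iff₀ (by positivity) (by positivity)]
    have hpos : 0 ≤ 16 * A ^ 2 * B ^ 2 * C ^ 2 / 2 := by positivity
    nlinarith [mul_le_mul_of_nonneg_left key hpos]
  linarith

noncomputable instance : MetricSpace HypSpace where
  dist_self p := by rw [dist_eq, dist_self, zero_div, Real.arsinh_zero, mul_zero]
  dist_comm p q := by simp only [dist_eq, dist_comm p.toEuclid, mul_comm]
  dist_triangle := dist_triangle'
  eq_of_dist_eq_zero {p q} h := by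
    have hp := p.t_pos
    have hq := q.t_pos
    have h1 := cosh_dist p q
    rw [h, Real.cosh_zero] at h1
    have h2 : (‖p.z - q.z‖ ^ 2 + (p.t - q.t) ^ 2) / (2 * p.t * q.t) = 0 := by linarith
    have h3 : ‖p.z - q.z‖ ^ 2 + (p.t - q.t) ^ 2 = 0 := by
      rcases div_eq_zero_iff.1 h2 with h | h
      · exact h
      · exact absurd h (by positivity)
    have h4 : ‖p.z - q.z‖ = 0 := by nlinarith [sq_nonneg ‖p.z - q.z‖, sq_nonneg (p.t - q.t)]
    have h5 : p.t - q.t = 0 := by nlinarith [sq_nonneg ‖p.z - q.z‖, sq_nonneg (p.t - q.t)]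
    exact HypSpace.ext (sub_eq_zero.1 (norm_eq_zero.1 h4)) (by linarith)

/-- The base point of hyperbolic `3`-space. -/
noncomputable def base : HypSpace := ⟨0, 1, one_pos⟩

/-- The bi-infinite geodesic `σ` with endpoints `0` and `∞`. -/
def axis : Set HypSpace := {p | p.z = 0}

/-- The underlying map of `φ_w`. -/
noncomputable def axialMap (w : ℂ) (p : HypSpace) : HypSpace :=
  ⟨Complex.exp w * p.z, Real.exp w.re * p.t, mul_pos (Real.exp_pos _) p.t_pos⟩

theorem axialMap_dist (w : ℂ) (p q : HypSpace) :
    dist (axialMap w p) (axialMap w q) = dist p q := by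
  have hp := p.t_pos
  have hq := q.t_pos
  have he := Real.exp_pos w.re
  rw [← abs_of_nonneg (dist_nonneg (x := p) (y := q)),
    ← abs_of_nonneg (dist_nonneg (x := axialMap w p) (y := axialMap w q))]
  refine le_antisymm (Real.cosh_le_cosh.1 (le_of_eq ?_)) (Real.cosh_le_cosh.1 (le_of_eq ?_))
  all_goals
    rw [cosh_dist, cosh_dist]
    simp only [axialMap]
    rw [← mul_sub, ← mul_sub, norm_mul, Complex.norm_exp]
    field_simp

theorem axialMap_neg (w : ℂ) (p : HypSpace) : axialMap (-w) (axialMap w p) = p := by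
  ext1
  · simp only [axialMap]
    rw [← mul_assoc, ← Complex.exp_add, neg_add_cancel, Complex.exp_zero, one_mul]
  · simp only [axialMap]
    rw [← mul_assoc, Complex.neg_re, ← Real.exp_add, neg_add_cancel, Real.exp_zero, one_mul]

/-- The isometry `φ_w` of hyperbolic `3`-space which translates the geodesic `axis` along itself by
distance `Re w` and rotates about it by the angle `Im w`, that is, of complex length `w`. -/
noncomputable def axialIsometry (w : ℂ) : HypSpace ≃ᵢ HypSpace where
  toFun := axialMap w
  invFun := axialMap (-w)
  left_inv := axialMap_neg w
  right_inv p := by simpa using axialMap_neg (-w) p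
  isometry_toFun := Isometry.of_dist_eq (axialMap_dist w)

end HypSpace

/-- Two points are equivalent when they lie in one orbit of the cyclic group generated by the
isometry of complex length `lam + i tau`. -/
def solidTorusSetoid (lam tau : ℝ) : Setoid HypSpace where
  r p q := ∃ g ∈ Subgroup.zpowers (HypSpace.axialIsometry ⟨lam, tau⟩), g p = q
  iseqv :=
    { refl := fun _ => ⟨1, one_mem _, rfl⟩
      symm := by
        rintro p q ⟨g, hg, rfl⟩
        exact ⟨g⁻¹, inv_mem hg, g.symm_apply_apply p⟩
      trans := by
        rintro p q r ⟨g, hg, rfl⟩ ⟨h, hh, rfl⟩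
        exact ⟨h * g, mul_mem hh hg, rfl⟩ }

/-- The nonsingular model solid torus `ℍ³ / ⟨φ_{lam + i tau}⟩` (meant for `lam > 0`), whose core
geodesic has complex length `lam + i tau`. -/
def SolidTorus (lam tau : ℝ) : Type := Quotient (solidTorusSetoid lam tau)

namespace SolidTorus

variable {lam tau : ℝ}

/-- The covering projection. -/
def proj (lam tau : ℝ) (p : HypSpace) : SolidTorus lam tau :=
  Quotient.mk (solidTorusSetoid lam tau) p

/-- The distances between a lift of `x` and a lift of `y`. -/
def liftDists (x y : SolidTorus lam tau) : Set ℝ :=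
  {d | ∃ p q : HypSpace, proj lam tau p = x ∧ proj lam tau q = y ∧ d = dist p q}

theorem liftDists_nonempty (x y : SolidTorus lam tau) : (liftDists x y).Nonempty := by
  obtain ⟨p, rfl⟩ := Quotient.exists_rep x
  obtain ⟨q, rfl⟩ := Quotient.exists_rep y
  exact ⟨_, p, q, rfl, rfl, rfl⟩

theorem liftDists_bddBelow (x y : SolidTorus lam tau) : BddBelow (liftDists x y) :=
  ⟨0, by rintro d ⟨p, q, -, -, rfl⟩; exact dist_nonneg⟩

/-- The quotient metric: the distance between two points is the infimum of the distances between
their lifts. (It is a genuine metric as soon as `lam > 0`.) -/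
noncomputable instance : PseudoMetricSpace (SolidTorus lam tau) where
  dist x y := sInf (liftDists x y)
  dist_self x := by
    obtain ⟨p, rfl⟩ := Quotient.exists_rep x
    refine le_antisymm (csInf_le (liftDists_bddBelow _ _) ⟨p, p, rfl, rfl, (dist_self p).symm⟩)
      (le_csInf (liftDists_nonempty _ _) ?_)
    rintro d ⟨p, q, -, -, rfl⟩
    exact dist_nonneg
  dist_comm x y := by
    congr 1
    ext d
    constructor
    · rintro ⟨p, q, hp, hq, rfl⟩
      exact ⟨q, p, hq, hp, dist_comm _ _⟩
    · rintro ⟨p, q, hp, hq, rfl⟩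
      exact ⟨q, p, hq, hp, dist_comm _ _⟩
  dist_triangle x y z := by
    refine le_of_forall_pos_le_add fun ε hε => ?_
    obtain ⟨_, ⟨p, q, hp, hq, rfl⟩, h1⟩ :=
      Real.lt_sInf_add_pos (liftDists_nonempty x y) (half_pos hε)
    obtain ⟨_, ⟨q', r, hq', hr, rfl⟩, h2⟩ :=
      Real.lt_sInf_add_pos (liftDists_nonempty y z) (half_pos hε)
    obtain ⟨g, hg, hgq⟩ : (solidTorusSetoid lam tau).r q' q :=
      Quotient.exact (s := solidTorusSetoid lam tau) (hq'.trans hq.symm)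
    have hr' : proj lam tau (g r) = z := by
      rw [← hr]
      exact (Quotient.sound (s := solidTorusSetoid lam tau) ⟨g, hg, rfl⟩).symm
    have h3 : sInf (liftDists x z) ≤ dist p (g r) :=
      csInf_le (liftDists_bddBelow _ _) ⟨p, g r, hp, hr', rfl⟩
    have h4 : dist p (g r) ≤ dist p q + dist q' r := by
      rw [← g.dist_eq q' r, hgq]
      exact dist_triangle _ _ _
    linarith

theorem dist_eq (x y : SolidTorus lam tau) : dist x y = sInf (liftDists x y) := rfl

/-- The core geodesic, the image of `axis`. -/
def core (lam tau : ℝ) : Set (SolidTorus lam tau) := proj lam tau '' HypSpace.axis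

/-- The open `r`-ball about `x` is isometric, as a Riemannian manifold, to the ball of radius `r`
about the base point of hyperbolic `3`-space: there is a bijection from the latter onto the former,
carrying centre to centre, which is a local isometry, i.e. every point has an open neighbourhood
that is mapped distance-preservingly onto an open set. (Asking that `f` preserve all distances of
the ambient space would be wrong, since two points of the ball may have a shortcut outside of it.
Values of `f` outside the ball are irrelevant.) -/
def IsHyperbolicBall (x : SolidTorus lam tau) (r : ℝ) : Prop :=
  ∃ f : HypSpace → SolidTorus lam tau,
    f HypSpace.base = x ∧
    Set.BijOn f (Metric.ball HypSpace.base r) (Metric.ball x r) ∧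
    ∀ p ∈ Metric.ball HypSpace.base r, ∃ U : Set HypSpace,
      IsOpen U ∧ p ∈ U ∧ U ⊆ Metric.ball HypSpace.base r ∧ IsOpen (f '' U) ∧
      ∀ q ∈ U, ∀ q' ∈ U, dist (f q) (f q') = dist q q'

/-- The injectivity radius at `x`: the supremal `r` such that the open `r`-ball about `x` is
isometric to a ball of radius `r` in hyperbolic `3`-space. -/
noncomputable def injrad (x : SolidTorus lam tau) : ℝ := sSup {r | 0 < r ∧ IsHyperbolicBall x r}

/-- The `ε`-thin part `N^{< ε}`: the complement of the points with `injrad x ≥ ε / 2`. -/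
def openThinPart (lam tau ε : ℝ) : Set (SolidTorus lam tau) := {x | ε / 2 ≤ injrad x}ᶜ

/-- The `ε`-thin part `N^{≤ ε}`. -/
def thinPart (lam tau ε : ℝ) : Set (SolidTorus lam tau) := {x | injrad x ≤ ε / 2}

/-- The equidistant torus `T_r` at distance `r` from the core. -/
def equidistantTorus (lam tau r : ℝ) : Set (SolidTorus lam tau) :=
  {x | Metric.infDist x (core lam tau) = r}

/-- The tube radius `r(ε)`: the common distance from the core of the points of
`T^ε = ∂ N^{≤ ε}`, so that `T^ε = T_{r(ε)}`. It is written as a supremum so as to be defined without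
further hypotheses. -/
noncomputable def tubeRadius (lam tau ε : ℝ) : ℝ :=
  sSup ((fun x => Metric.infDist x (core lam tau)) '' frontier (thinPart lam tau ε))

end SolidTorus

/-! Write φ for the generating isometry, R for the distance of a point to the axis and a = sinh² R.
The injectivity radius at a point of `N` is half the least displacement of a lift under the nonzero
powers of φ, and by `cosh_dist_axialMap` an isometry of complex length w has displacement d with
cosh d = a (cosh Re w − cos Im w) + cosh Re w. The power φ^n turns by exactly 2π and translates by
1/n = √λ, so cosh d − 1 = cosh² R · (cosh √λ − 1).

Any other power either translates at least as far (when n divides the exponent) or turns by at least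
2π/n modulo 2π. Once φ^n moves a point by 1.016/n or more, a is large enough for this turning to
cost more than φ^n does (`displacement_pow_le`). Hence for ε ≥ 1.016/n the thin part is where φ^n
displaces by at most ε, a tube about the core whose radius satisfies cosh² r = (cosh ε − 1)/(cosh √λ
− 1). Half-angle formulas turn cosh r into sinh(ε/2)/sinh(√λ/2), which is estimated by convexity and
Taylor bounds.

The geometric point is that an abstract hyperbolic ball of radius r about the image of p forces
every nontrivial power to move p by at least 2r (`IsHyperbolicBall.two_mul_le_dist`). Inverting the
chart gives a locally isometric, φ-invariant map on the r-ball about p, and uniqueness of geodesics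
then excludes short loops. -/

namespace HypSpace

/-! ### Hyperboloid model and geodesics -/

/-- The Lorentzian form on `ℝ⁴` in light-cone coordinates. -/
def lorentzForm (v w : ℝ × ℝ × ℝ × ℝ) : ℝ :=
  v.1 * w.2.1 + v.2.1 * w.1 - 2 * (v.2.2.1 * w.2.2.1 + v.2.2.2 * w.2.2.2)

/-- The embedding of hyperbolic space as a hyperboloid, in light-cone coordinates. -/
noncomputable def toLorentz (p : HypSpace) : ℝ × ℝ × ℝ × ℝ :=
  ((p.z.re ^ 2 + p.z.im ^ 2 + p.t ^ 2) / p.t, 1 / p.t, p.z.re / p.t, p.z.im / p.t)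

theorem norm_z_sub_sq (p q : HypSpace) :
    ‖p.z - q.z‖ ^ 2 = (p.z.re - q.z.re) ^ 2 + (p.z.im - q.z.im) ^ 2 := by
  rw [Complex.sq_norm, Complex.normSq_apply, Complex.sub_re, Complex.sub_im]
  ring

theorem lorentzForm_toLorentz (p q : HypSpace) :
    lorentzForm p.toLorentz q.toLorentz = 2 * Real.cosh (dist p q) := by
  have hp := p.t_pos
  have hq := q.t_pos
  rw [cosh_dist, norm_z_sub_sq]
  simp only [lorentzForm, toLorentz]
  field_simp
  ring

theorem lorentzForm_toLorentz_self (p : HypSpace) :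
    lorentzForm p.toLorentz p.toLorentz = 2 := by
  rw [lorentzForm_toLorentz, dist_self, Real.cosh_zero, mul_one]

theorem toLorentz_injective : Function.Injective toLorentz := by
  intro p q h
  have hp := p.t_pos
  have hq := q.t_pos
  simp only [toLorentz, Prod.mk.injEq] at h
  obtain ⟨-, h2, h3, h4⟩ := h
  have ht : p.t = q.t := by
    field_simp at h2
    exact h2.symm
  rw [ht] at h3 h4
  refine HypSpace.ext (Complex.ext ?_ ?_) ht
  · field_simp at h3
    exact h3
  · field_simp at h4
    exact h4

theorem exists_toLorentz_eq {v : ℝ × ℝ × ℝ × ℝ} (h : lorentzForm v v = 2) (hv : 0 < v.2.1) :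
    ∃ p : HypSpace, p.toLorentz = v := by
  obtain ⟨a, b, x, y⟩ := v
  simp only [lorentzForm] at h hv
  refine ⟨⟨⟨x / b, y / b⟩, 1 / b, by positivity⟩, ?_⟩
  simp only [toLorentz, Prod.mk.injEq]
  refine ⟨?_, by field_simp, by field_simp, by field_simp⟩
  field_simp
  linarith

/-- The orthogonal complement of a timelike vector is definite; in coordinates, a sum of squares
vanishes. This is the rigidity behind uniqueness of geodesics. -/
theorem eq_zero_of_lorentzForm_eq_zero {w : ℝ × ℝ × ℝ × ℝ} {p : HypSpace}
    (h : lorentzForm w w = 0) (hp : lorentzForm w p.toLorentz = 0) : w = 0 := by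
  have h1 := lorentzForm_toLorentz_self p
  have hb : 0 < p.toLorentz.2.1 := one_div_pos.2 p.t_pos
  generalize p.toLorentz = v at hp h1 hb
  obtain ⟨a, b, x, y⟩ := w
  obtain ⟨a', b', x', y'⟩ := v
  simp only [lorentzForm] at h hp h1 hb
  have hab : a * b = x ^ 2 + y ^ 2 := by linarith
  have hab' : a' * b' = x' ^ 2 + y' ^ 2 + 1 := by linarith
  have ha' : 0 < a' := by
    by_contra! hn
    nlinarith [sq_nonneg x', sq_nonneg y']
  have hsum : a * b' + b * a' = 2 * (x * x' + y * y') := by linarith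
  have hkey : (a * b' - b * a') ^ 2 + 4 * (x * y' - y * x') ^ 2 + 4 * (x ^ 2 + y ^ 2) = 0 := by
    have : (a * b' - b * a') ^ 2 = (a * b' + b * a') ^ 2 - 4 * (a * b) * (a' * b') := by ring
    rw [this, hsum, hab, hab']
    ring
  have hx : x = 0 := by
    nlinarith [sq_nonneg (a * b' - b * a'), sq_nonneg (x * y' - y * x'), sq_nonneg x, sq_nonneg y]
  have hy : y = 0 := by
    nlinarith [sq_nonneg (a * b' - b * a'), sq_nonneg (x * y' - y * x'), sq_nonneg x, sq_nonneg y]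
  subst hx hy
  have h3 : a * b' = b * a' := by nlinarith [sq_nonneg (a * b' - b * a')]
  have h4 : a * b' = 0 := by linarith
  have h5 : b * a' = 0 := by linarith
  have ha : a = 0 := (mul_eq_zero.1 h4).resolve_right hb.ne'
  have hb0 : b = 0 := (mul_eq_zero.1 h5).resolve_right ha'.ne'
  subst ha hb0
  rfl

/-- Three equally spaced points of a geodesic satisfy a linear recurrence. -/
theorem toLorentz_add_of_dist_eq {a b c : HypSpace} {h : ℝ} (hab : dist a b = h)
    (hbc : dist b c = h) (hac : dist a c = 2 * h) :
    a.toLorentz + c.toLorentz = (2 * Real.cosh h) • b.toLorentz := by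
  have haa := lorentzForm_toLorentz_self a
  have hbb := lorentzForm_toLorentz_self b
  have hcc := lorentzForm_toLorentz_self c
  have ab := lorentzForm_toLorentz a b
  have bc := lorentzForm_toLorentz b c
  have ac := lorentzForm_toLorentz a c
  rw [hab] at ab
  rw [hbc] at bc
  rw [hac, Real.cosh_two_mul, Real.sinh_sq] at ac
  rw [← sub_eq_zero]
  -- The defect a + c − 2 cosh(h) b is null and orthogonal to b.
  apply eq_zero_of_lorentzForm_eq_zero (p := b)
  · simp only [lorentzForm, Prod.fst_add, Prod.snd_add, Prod.fst_sub, Prod.snd_sub, Prod.smul_fst,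
      Prod.smul_snd, smul_eq_mul] at *
    linear_combination haa + hcc + 4 * Real.cosh h ^ 2 * hbb + 2 * ac - 4 * Real.cosh h * ab
      - 4 * Real.cosh h * bc
  · simp only [lorentzForm, Prod.fst_add, Prod.snd_add, Prod.fst_sub, Prod.snd_sub, Prod.smul_fst,
      Prod.smul_snd, smul_eq_mul] at *
    linear_combination ab + bc - 2 * Real.cosh h * hbb

theorem dist_eq_of_lorentzForm {p q : HypSpace} {s : ℝ}
    (h : lorentzForm p.toLorentz q.toLorentz = 2 * Real.cosh s) : dist p q = |s| := by
  rw [lorentzForm_toLorentz] at h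
  have h' := mul_left_cancel₀ two_ne_zero h
  rw [← abs_of_nonneg (dist_nonneg (x := p) (y := q))]
  exact le_antisymm (Real.cosh_le_cosh.1 h'.le) (Real.cosh_le_cosh.1 h'.ge)

/-- The geodesic is the hyperbolic analogue of spherical linear interpolation between p and q on the
hyperboloid. -/
theorem exists_geodesic {p q : HypSpace} (hpq : p ≠ q) :
    ∃ c : ℝ → HypSpace, c 0 = p ∧ c (dist p q) = q ∧
      ∀ s ∈ Set.Icc 0 (dist p q), ∀ s' ∈ Set.Icc 0 (dist p q), dist (c s) (c s') = |s - s'| := by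
  set d := dist p q with hd
  have hd0 : 0 < d := dist_pos.2 hpq
  have hS : 0 < Real.sinh d := Real.sinh_pos_iff.2 hd0
  have hpp := lorentzForm_toLorentz_self p
  have hqq := lorentzForm_toLorentz_self q
  have hpq' := lorentzForm_toLorentz p q
  have hbp : 0 < p.toLorentz.2.1 := one_div_pos.2 p.t_pos
  have hbq : 0 < q.toLorentz.2.1 := one_div_pos.2 q.t_pos
  rw [← hd] at hpq'
  let v : ℝ → ℝ × ℝ × ℝ × ℝ := fun s =>
    (Real.sinh (d - s) / Real.sinh d) • p.toLorentz + (Real.sinh s / Real.sinh d) • q.toLorentz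
  have hv : ∀ s s', lorentzForm (v s) (v s') = 2 * Real.cosh (s - s') := by
    intro s s'
    have h1 : lorentzForm (v s) (v s') =
        (2 * (Real.sinh (d - s) * Real.sinh (d - s')) + 2 * (Real.sinh s * Real.sinh s') +
          2 * Real.cosh d * (Real.sinh (d - s) * Real.sinh s' + Real.sinh s * Real.sinh (d - s')))
          / Real.sinh d ^ 2 := by
      rw [eq_div_iff (by positivity)]
      simp only [v, lorentzForm, Prod.fst_add, Prod.snd_add, Prod.smul_fst,
        Prod.smul_snd, smul_eq_mul] at *
      field_simp
      linear_combination (Real.sinh (d - s) * Real.sinh (d - s')) * hpp +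
        (Real.sinh s * Real.sinh s') * hqq +
        (Real.sinh (d - s) * Real.sinh s' + Real.sinh s * Real.sinh (d - s')) * hpq'
    rw [h1, div_eq_iff (by positivity), Real.cosh_sub, Real.sinh_sub, Real.sinh_sub]
    have e := Real.cosh_sq' d
    linear_combination (-2 * Real.sinh s * Real.sinh s') * e
  have hex : ∀ s ∈ Set.Icc 0 d, ∃ x : HypSpace, x.toLorentz = v s := by
    intro s hs
    refine exists_toLorentz_eq (by rw [hv, sub_self, Real.cosh_zero, mul_one]) ?_
    have h1 : 0 ≤ Real.sinh (d - s) := Real.sinh_nonneg_iff.2 (by linarith [hs.2])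
    have h2 : 0 ≤ Real.sinh s := Real.sinh_nonneg_iff.2 hs.1
    have h3 : 0 < Real.sinh (d - s) ∨ 0 < Real.sinh s := by
      rcases hs.1.eq_or_lt with h | h
      · left
        rw [← h, sub_zero]
        exact hS
      · exact Or.inr (Real.sinh_pos_iff.2 h)
    simp only [v, Prod.snd_add, Prod.fst_add, Prod.smul_fst, Prod.smul_snd, smul_eq_mul]
    rcases h3 with h3 | h3 <;> positivity
  have : Nonempty HypSpace := ⟨p⟩
  choose! c hc using hex
  have h0 : (0 : ℝ) ∈ Set.Icc 0 d := ⟨le_rfl, hd0.le⟩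
  have h1 : d ∈ Set.Icc 0 d := ⟨hd0.le, le_rfl⟩
  refine ⟨c, toLorentz_injective ?_, toLorentz_injective ?_, fun s hs s' hs' => ?_⟩
  · rw [hc 0 h0]
    simp [v, hS.ne']
  · rw [hc d h1]
    simp [v, hS.ne']
  · apply dist_eq_of_lorentzForm
    rw [hc s hs, hc s' hs', hv]

/-- Used in both directions: u 0 and u 1 determine u N, and u 0 and u N determine u 1 because sinh(N
h) ≠ 0. Discretized geodesics are thus fixed by their endpoints or by their first step. -/
theorem sinh_smul_eq_of_recurrence {V : Type*} [AddCommGroup V] [Module ℝ V] {h : ℝ} {N : ℕ}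
    {u : ℕ → V} (hu : ∀ k, k + 2 ≤ N → u k + u (k + 2) = (2 * Real.cosh h) • u (k + 1)) (k : ℕ)
    (hk : k ≤ N) :
    Real.sinh h • u k = Real.sinh (k * h) • u 1 - Real.sinh ((k - 1) * h) • u 0 := by
  induction k using Nat.twoStepInduction with
  | zero => simp
  | one => simp
  | more k ih1 ih2 =>
    have e : u (k + 2) = (2 * Real.cosh h) • u (k + 1) - u k := by
      rw [← hu k hk, add_sub_cancel_left]
    rw [e, smul_sub, ih1 (by omega), smul_comm, ih2 (by omega)]
    have a1 : (((k + 1 + 1 : ℕ) : ℝ)) * h = (k + 1 : ℕ) * h + h := by push_cast; ring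
    have a2 : (((k + 1 + 1 : ℕ) : ℝ) - 1) * h = (k : ℝ) * h + h := by push_cast; ring
    have a3 : (k : ℝ) * h = (k + 1 : ℕ) * h - h := by push_cast; ring
    have a4 : ((k : ℝ) - 1) * h = k * h - h := by ring
    have a5 : (((k + 1 : ℕ) : ℝ) - 1) * h = k * h := by push_cast; ring
    have b1 : Real.sinh ((k + 1 + 1 : ℕ) * h) =
        2 * Real.cosh h * Real.sinh ((k + 1 : ℕ) * h) - Real.sinh (k * h) := by
      rw [a1, a3, Real.sinh_add, Real.sinh_sub]
      ring
    have b2 : Real.sinh (((k + 1 + 1 : ℕ) - 1) * h) =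
        2 * Real.cosh h * Real.sinh (k * h) - Real.sinh ((k - 1) * h) := by
      rw [a2, a4, Real.sinh_add, Real.sinh_sub]
      ring
    rw [b1, b2, a5]
    module

/-! ### Locally isometric maps invariant under an isometry -/

/-- A map which is locally distance preserving does not identify the far ends of two geodesics
issuing from one point. -/
theorem eq_of_locally_isometric {G : HypSpace → HypSpace} {S : Set HypSpace}
    (hG : ∀ q ∈ S, ∃ δ > 0, ∀ a ∈ Metric.ball q δ, ∀ b ∈ Metric.ball q δ,
      dist (G a) (G b) = dist a b)
    {m : ℝ} (hm : 0 < m) {c₁ c₂ : ℝ → HypSpace}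
    (h₁ : ∀ s ∈ Set.Icc 0 m, ∀ s' ∈ Set.Icc 0 m, dist (c₁ s) (c₁ s') = |s - s'|)
    (h₂ : ∀ s ∈ Set.Icc 0 m, ∀ s' ∈ Set.Icc 0 m, dist (c₂ s) (c₂ s') = |s - s'|)
    (hS₁ : ∀ s ∈ Set.Icc 0 m, c₁ s ∈ S) (hS₂ : ∀ s ∈ Set.Icc 0 m, c₂ s ∈ S)
    (h0 : c₁ 0 = c₂ 0) (hend : G (c₁ m) = G (c₂ m)) : c₁ m = c₂ m := by
  have hcont : ∀ c : ℝ → HypSpace,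
      (∀ s ∈ Set.Icc 0 m, ∀ s' ∈ Set.Icc 0 m, dist (c s) (c s') = |s - s'|) →
      IsCompact (c '' Set.Icc 0 m) := by
    intro c hc
    refine isCompact_Icc.image_of_continuousOn ?_
    have : LipschitzOnWith 1 c (Set.Icc 0 m) := LipschitzOnWith.of_dist_le_mul fun s hs s' hs' => by
      rw [hc s hs s' hs', NNReal.coe_one, one_mul, Real.dist_eq]
    exact this.continuousOn
  have hK := (hcont c₁ h₁).union (hcont c₂ h₂)
  choose! δ hδ hGδ using hG
  obtain ⟨η, hη, hball⟩ := lebesgue_number_lemma_of_metric (ι := S) hK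
    (c := fun q => Metric.ball (q : HypSpace) (δ q)) (fun _ => Metric.isOpen_ball) (by
      rintro x hx
      have hxS : x ∈ S := by
        rcases hx with ⟨s, hs, rfl⟩ | ⟨s, hs, rfl⟩
        · exact hS₁ s hs
        · exact hS₂ s hs
      exact Set.mem_iUnion.2 ⟨⟨x, hxS⟩, Metric.mem_ball_self (hδ x hxS)⟩)
  have hloc : ∀ x ∈ c₁ '' Set.Icc 0 m ∪ c₂ '' Set.Icc 0 m,
      ∀ a ∈ Metric.ball x η, ∀ b ∈ Metric.ball x η, dist (G a) (G b) = dist a b := by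
    intro x hx a ha b hb
    obtain ⟨q, hq⟩ := hball x hx
    exact hGδ q q.2 a (hq ha) b (hq hb)
  -- The step m / N is below the Lebesgue number, so three consecutive sample points lie where `G`
  -- preserves distances, and their images satisfy the same recurrence.
  obtain ⟨N, hN⟩ := exists_nat_gt (m / η)
  have hN0 : (0 : ℝ) < N := lt_of_le_of_lt (by positivity) hN
  set h := m / N with hh
  have hhpos : 0 < h := by positivity
  have hhη : h < η := by
    rw [hh, div_lt_iff₀ hN0, mul_comm]
    exact (div_lt_iff₀ hη).1 hN
  have hNh : N * h = m := by rw [hh]; field_simp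
  have hmem : ∀ k : ℕ, k ≤ N → (k : ℝ) * h ∈ Set.Icc 0 m := by
    intro k hk
    refine ⟨by positivity, ?_⟩
    rw [← hNh]
    have : (k : ℝ) ≤ N := by exact_mod_cast hk
    gcongr
  have hrec : ∀ c : ℝ → HypSpace,
      (∀ s ∈ Set.Icc 0 m, ∀ s' ∈ Set.Icc 0 m, dist (c s) (c s') = |s - s'|) →
      c '' Set.Icc 0 m ⊆ c₁ '' Set.Icc 0 m ∪ c₂ '' Set.Icc 0 m → ∀ k : ℕ, k + 2 ≤ N →
        ((c (k * h)).toLorentz + (c ((k + 2 : ℕ) * h)).toLorentz =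
          (2 * Real.cosh h) • (c ((k + 1 : ℕ) * h)).toLorentz) ∧
        ((G (c (k * h))).toLorentz + (G (c ((k + 2 : ℕ) * h))).toLorentz =
          (2 * Real.cosh h) • (G (c ((k + 1 : ℕ) * h))).toLorentz) := by
    intro c hc hsub k hk
    have m0 := hmem k (by omega)
    have m1 := hmem (k + 1) (by omega)
    have m2 := hmem (k + 2) hk
    have d1 : dist (c (k * h)) (c ((k + 1 : ℕ) * h)) = h := by
      rw [hc _ m0 _ m1, show (k : ℝ) * h - (k + 1 : ℕ) * h = -h by push_cast; ring, abs_neg,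
        abs_of_pos hhpos]
    have d2 : dist (c ((k + 1 : ℕ) * h)) (c ((k + 2 : ℕ) * h)) = h := by
      rw [hc _ m1 _ m2, show ((k + 1 : ℕ) : ℝ) * h - (k + 2 : ℕ) * h = -h by push_cast; ring,
        abs_neg, abs_of_pos hhpos]
    have d3 : dist (c (k * h)) (c ((k + 2 : ℕ) * h)) = 2 * h := by
      rw [hc _ m0 _ m2, show (k : ℝ) * h - (k + 2 : ℕ) * h = -(2 * h) by push_cast; ring, abs_neg,
        abs_of_pos (by positivity)]
    have hb := hloc (c ((k + 1 : ℕ) * h)) (hsub ⟨_, m1, rfl⟩)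
    have b0 : c (k * h) ∈ Metric.ball (c ((k + 1 : ℕ) * h)) η := by
      rw [Metric.mem_ball, d1]
      exact hhη
    have b1 := Metric.mem_ball_self (x := c ((k + 1 : ℕ) * h)) hη
    have b2 : c ((k + 2 : ℕ) * h) ∈ Metric.ball (c ((k + 1 : ℕ) * h)) η := by
      rw [Metric.mem_ball, dist_comm, d2]
      exact hhη
    exact ⟨toLorentz_add_of_dist_eq d1 d2 d3, toLorentz_add_of_dist_eq
      ((hb _ b0 _ b1).trans d1) ((hb _ b1 _ b2).trans d2) ((hb _ b0 _ b2).trans d3)⟩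
  have r₁ := hrec c₁ h₁ Set.subset_union_left
  have r₂ := hrec c₂ h₂ Set.subset_union_right
  have hN1 : 1 ≤ N := by exact_mod_cast hN0
  -- The image sequences share both endpoints, hence their first step; `G` is injective near the
  -- common origin, so the curves themselves share it.
  have hfirst : c₁ ((1 : ℕ) * h) = c₂ ((1 : ℕ) * h) := by
    have s₁ := sinh_smul_eq_of_recurrence (u := fun k => (G (c₁ (k * h))).toLorentz)
      (fun k hk => (r₁ k hk).2) N le_rfl
    have s₂ := sinh_smul_eq_of_recurrence (u := fun k => (G (c₂ (k * h))).toLorentz)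
      (fun k hk => (r₂ k hk).2) N le_rfl
    have e : (G (c₁ ((1 : ℕ) * h))).toLorentz = (G (c₂ ((1 : ℕ) * h))).toLorentz := by
      simp only [Nat.cast_zero, zero_mul, hNh, hend, h0] at s₁ s₂
      have s := sub_left_injective (s₁.symm.trans s₂)
      exact smul_right_injective _ (Real.sinh_pos_iff.2 hm).ne' s
    have e' := toLorentz_injective e
    have hb := hloc (c₁ 0) (Or.inl ⟨0, ⟨le_rfl, hm.le⟩, rfl⟩)
    have m1 := hmem 1 hN1
    have hz : (0 : ℝ) ∈ Set.Icc 0 m := ⟨le_rfl, hm.le⟩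
    have hd : |((1 : ℕ) : ℝ) * h - 0| < η := by
      rw [Nat.cast_one, one_mul, sub_zero, abs_of_pos hhpos]
      exact hhη
    have b1 : c₁ ((1 : ℕ) * h) ∈ Metric.ball (c₁ 0) η := by
      rw [Metric.mem_ball, h₁ _ m1 _ hz]
      exact hd
    have b2 : c₂ ((1 : ℕ) * h) ∈ Metric.ball (c₁ 0) η := by
      rw [h0, Metric.mem_ball, h₂ _ m1 _ hz]
      exact hd
    exact dist_eq_zero.1 ((hb _ b1 _ b2).symm.trans (by rw [e', dist_self]))
  have s₁ := sinh_smul_eq_of_recurrence (u := fun k => (c₁ (k * h)).toLorentz)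
    (fun k hk => (r₁ k hk).1) N le_rfl
  have s₂ := sinh_smul_eq_of_recurrence (u := fun k => (c₂ (k * h)).toLorentz)
    (fun k hk => (r₂ k hk).1) N le_rfl
  simp only [hfirst, Nat.cast_zero, zero_mul, h0] at s₁ s₂
  have s := smul_right_injective _ (Real.sinh_pos_iff.2 hhpos).ne' (s₁.trans s₂.symm)
  have := toLorentz_injective s
  rwa [hNh] at this

/-- If a map defined on a ball is locally distance preserving and invariant under a fixed point free
isometry, then that isometry moves the ball off itself. -/
theorem two_mul_le_dist_of_locally_isometric {G : HypSpace → HypSpace} {p : HypSpace} {r : ℝ}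
    (hG : ∀ q ∈ Metric.ball p r, ∃ δ > 0, ∀ a ∈ Metric.ball q δ, ∀ b ∈ Metric.ball q δ,
      dist (G a) (G b) = dist a b)
    {γ : HypSpace ≃ᵢ HypSpace} (hγ : ∀ q, γ q ≠ q) (hGγ : ∀ q, G (γ q) = G q) :
    2 * r ≤ dist p (γ p) := by
  by_contra! hlt
  obtain ⟨c, c0, c1, hc⟩ := exists_geodesic (hγ p).symm
  have hd0 : 0 < dist p (γ p) := dist_pos.2 (hγ p).symm
  set d := dist p (γ p) with hd
  have hsub : ∀ s ∈ Set.Icc 0 (d / 2), s ∈ Set.Icc 0 d := fun s hs => ⟨hs.1, by linarith [hs.2]⟩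
  have hsub' : ∀ s ∈ Set.Icc 0 (d / 2), d - s ∈ Set.Icc 0 d :=
    fun s hs => ⟨by linarith [hs.2], by linarith [hs.1]⟩
  have hz : (0 : ℝ) ∈ Set.Icc 0 (d / 2) := ⟨le_rfl, by positivity⟩
  have h₁ : ∀ s ∈ Set.Icc 0 (d / 2), ∀ s' ∈ Set.Icc 0 (d / 2), dist (c s) (c s') = |s - s'| :=
    fun s hs s' hs' => hc s (hsub s hs) s' (hsub s' hs')
  have h₂ : ∀ s ∈ Set.Icc 0 (d / 2), ∀ s' ∈ Set.Icc 0 (d / 2),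
      dist (γ.symm (c (d - s))) (γ.symm (c (d - s'))) = |s - s'| := by
    intro s hs s' hs'
    rw [γ.symm.dist_eq, hc _ (hsub' s hs) _ (hsub' s' hs'), sub_sub_sub_cancel_left, abs_sub_comm]
  have e0 : c 0 = γ.symm (c (d - 0)) := by
    rw [sub_zero, c0, c1, γ.symm_apply_apply]
  -- Compare the first half of the geodesic from p to γ p with the reversed second half pulled back
  -- by γ⁻¹. Both start at p and stay in the ball as d / 2 < r. Their ends are identified by `G`; if
  -- equal, the midpoint would be fixed by γ.
  have key := eq_of_locally_isometric (c₁ := c) (c₂ := fun s => γ.symm (c (d - s)))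
    hG (half_pos hd0) h₁ h₂ ?_ ?_ e0 ?_
  · have : γ (c (d / 2)) = c (d / 2) := by
      conv_lhs => rw [key]
      simp only [γ.apply_symm_apply]
      congr 1
      ring
    exact hγ _ this
  · intro s hs
    have := h₁ s hs 0 hz
    rw [c0, sub_zero, abs_of_nonneg hs.1] at this
    rw [Metric.mem_ball, this]
    linarith [hs.2]
  · intro s hs
    have := h₂ s hs 0 hz
    rw [← e0, c0, sub_zero, abs_of_nonneg hs.1] at this
    rw [Metric.mem_ball, this]
    linarith [hs.2]
  · have := hGγ (γ.symm (c (d - d / 2)))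
    rw [γ.apply_symm_apply] at this
    rw [← this]
    congr 2
    ring

end HypSpace
-- Powers of the axial isometry and their displacement
namespace HypSpace

theorem axialMap_add (w w' : ℂ) (p : HypSpace) :
    axialMap (w + w') p = axialMap w (axialMap w' p) := by
  ext1
  · simp only [axialMap]
    rw [Complex.exp_add, mul_assoc]
  · simp only [axialMap]
    rw [Complex.add_re, Real.exp_add, mul_assoc]

theorem axialMap_zero (p : HypSpace) : axialMap 0 p = p := by
  ext1 <;> simp [axialMap]

theorem axialIsometry_apply (w : ℂ) (p : HypSpace) : axialIsometry w p = axialMap w p := rfl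

theorem axialIsometry_zpow_apply (w : ℂ) (k : ℤ) (p : HypSpace) :
    (axialIsometry w ^ k) p = axialMap (k * w) p := by
  have hnat : ∀ (k : ℕ) (q : HypSpace), (axialIsometry w ^ k) q = axialMap (k * w) q := by
    intro k
    induction k with
    | zero =>
      intro q
      rw [Nat.cast_zero, zero_mul, axialMap_zero]
      rfl
    | succ k ih =>
      intro q
      rw [pow_succ, IsometryEquiv.mul_apply, ih, axialIsometry_apply, ← axialMap_add]
      congr 1
      push_cast
      ring
  cases k with
  | ofNat k => simpa using hnat k p
  | negSucc k =>
    rw [zpow_negSucc]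
    have h : axialMap (Int.negSucc k * w) p = (axialIsometry w ^ (k + 1)).symm p := by
      rw [IsometryEquiv.eq_symm_apply, hnat, ← axialMap_add]
      convert axialMap_zero p using 2
      rw [Int.cast_negSucc]
      ring
    rw [h]
    rfl

theorem cosh_dist_axialMap (w : ℂ) (p : HypSpace) :
    Real.cosh (dist p (axialMap w p)) =
      (‖p.z‖ / p.t) ^ 2 * (Real.cosh w.re - Real.cos w.im) + Real.cosh w.re := by
  have hp := p.t_pos
  have he := Real.exp_pos w.re
  have h1 : ‖p.z - Complex.exp w * p.z‖ ^ 2 =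
      (1 - 2 * Real.exp w.re * Real.cos w.im + Real.exp w.re ^ 2) * ‖p.z‖ ^ 2 := by
    rw [show p.z - Complex.exp w * p.z = (1 - Complex.exp w) * p.z by ring, norm_mul, mul_pow]
    congr 1
    rw [Complex.sq_norm, Complex.normSq_apply, Complex.sub_re, Complex.sub_im, Complex.exp_re,
      Complex.exp_im, Complex.one_re, Complex.one_im]
    linear_combination (Real.exp w.re ^ 2) * Real.sin_sq_add_cos_sq w.im
  rw [cosh_dist]
  simp only [axialMap]
  rw [h1, Real.cosh_eq w.re, Real.exp_neg]
  field_simp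
  ring

theorem abs_re_le_dist_axialMap (w : ℂ) (p : HypSpace) : |w.re| ≤ dist p (axialMap w p) := by
  rw [← abs_of_nonneg (dist_nonneg (x := p) (y := axialMap w p)), ← Real.cosh_le_cosh,
    cosh_dist_axialMap]
  have h := Real.one_le_cosh w.re
  have h' := Real.cos_le_one w.im
  have : 0 ≤ (‖p.z‖ / p.t) ^ 2 * (Real.cosh w.re - Real.cos w.im) :=
    mul_nonneg (sq_nonneg _) (by linarith)
  linarith

/-- The isometry of hyperbolic space carrying the base point to `p` by a dilation followed by a
horizontal translation. -/
noncomputable def fromBase (p : HypSpace) : HypSpace ≃ᵢ HypSpace where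
  toFun q := ⟨p.z + p.t * q.z, p.t * q.t, mul_pos p.t_pos q.t_pos⟩
  invFun q := ⟨(q.z - p.z) / p.t, q.t / p.t, div_pos q.t_pos p.t_pos⟩
  left_inv q := by
    have hp := p.t_pos.ne'
    have hp' : (p.t : ℂ) ≠ 0 := Complex.ofReal_ne_zero.2 hp
    ext1
    · dsimp only
      field_simp
      ring
    · dsimp only
      field_simp
  right_inv q := by
    have hp := p.t_pos.ne'
    have hp' : (p.t : ℂ) ≠ 0 := Complex.ofReal_ne_zero.2 hp
    ext1
    · dsimp only
      field_simp
      ring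
    · dsimp only
      field_simp
  isometry_toFun := Isometry.of_dist_eq fun a b => by
    have hp := p.t_pos
    have ha := a.t_pos
    have hb := b.t_pos
    have h : Real.cosh (dist (⟨p.z + p.t * a.z, p.t * a.t, mul_pos p.t_pos a.t_pos⟩ : HypSpace)
        ⟨p.z + p.t * b.z, p.t * b.t, mul_pos p.t_pos b.t_pos⟩) = Real.cosh (dist a b) := by
      rw [cosh_dist, cosh_dist]
      dsimp only
      rw [add_sub_add_left_eq_sub, ← mul_sub, norm_mul, Complex.norm_real, Real.norm_of_nonneg hp.le]
      field_simp
    rw [← abs_of_nonneg (dist_nonneg (x := a) (y := b)), ← abs_of_nonneg (dist_nonneg (α := HypSpace))]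
    exact le_antisymm (Real.cosh_le_cosh.1 h.le) (Real.cosh_le_cosh.1 h.ge)

theorem fromBase_base (p : HypSpace) : fromBase p base = p := by
  ext1 <;> simp [fromBase, base]

end HypSpace

/-! ### The covering projection, injectivity radius and distance to the core -/

namespace SolidTorus

open HypSpace

variable {lam tau : ℝ}

theorem proj_surjective : Function.Surjective (proj lam tau) := Quotient.exists_rep

theorem proj_eq_proj_iff {p q : HypSpace} :
    proj lam tau p = proj lam tau q ↔ ∃ k : ℤ, axialMap (k * ⟨lam, tau⟩) p = q := by
  constructor
  · intro h
    obtain ⟨g, ⟨k, rfl⟩, hg⟩ : (solidTorusSetoid lam tau).r p q :=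
      Quotient.exact (s := solidTorusSetoid lam tau) h
    exact ⟨k, by rw [← hg, ← axialIsometry_zpow_apply]⟩
  · rintro ⟨k, rfl⟩
    exact Quotient.sound (s := solidTorusSetoid lam tau)
      ⟨_, ⟨k, rfl⟩, axialIsometry_zpow_apply _ _ _⟩

theorem proj_axialMap (k : ℤ) (p : HypSpace) :
    proj lam tau (axialMap (k * ⟨lam, tau⟩) p) = proj lam tau p :=
  (proj_eq_proj_iff.2 ⟨k, rfl⟩).symm

theorem dist_proj_le (p q : HypSpace) : dist (proj lam tau p) (proj lam tau q) ≤ dist p q :=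
  csInf_le (liftDists_bddBelow _ _) ⟨p, q, rfl, rfl, rfl⟩

theorem continuous_proj : Continuous (proj lam tau) :=
  (LipschitzWith.of_dist_le_mul (K := 1) fun p q => by simpa using dist_proj_le p q).continuous

theorem exists_axialMap_dist_eq {x y : SolidTorus lam tau} {q : HypSpace} {d : ℝ}
    (hd : d ∈ liftDists x y) (p : HypSpace) (hp : proj lam tau p = x) (hq : proj lam tau q = y) :
    ∃ k : ℤ, d = dist p (axialMap (k * ⟨lam, tau⟩) q) := by
  obtain ⟨p', q', hp', hq', rfl⟩ := hd
  obtain ⟨i, rfl⟩ := proj_eq_proj_iff.1 (hp.trans hp'.symm)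
  obtain ⟨j, rfl⟩ := proj_eq_proj_iff.1 (hq.trans hq'.symm)
  refine ⟨-i + j, ?_⟩
  rw [← axialMap_dist (i * ⟨lam, tau⟩) p (axialMap _ q), ← axialMap_add]
  congr 2
  push_cast
  ring

theorem le_dist_proj {p q : HypSpace} {c : ℝ}
    (h : ∀ k : ℤ, c ≤ dist p (axialMap (k * ⟨lam, tau⟩) q)) :
    c ≤ dist (proj lam tau p) (proj lam tau q) := by
  refine le_csInf (liftDists_nonempty _ _) fun d hd => ?_
  obtain ⟨k, rfl⟩ := exists_axialMap_dist_eq hd p rfl rfl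
  exact h k

theorem exists_lift_dist_lt {p : HypSpace} {y : SolidTorus lam tau} {r : ℝ}
    (h : dist (proj lam tau p) y < r) : ∃ q, proj lam tau q = y ∧ dist p q < r := by
  obtain ⟨q, rfl⟩ := proj_surjective y
  obtain ⟨d, hd, hdr⟩ := exists_lt_of_csInf_lt (liftDists_nonempty _ _) h
  obtain ⟨k, rfl⟩ := exists_axialMap_dist_eq hd p rfl rfl
  exact ⟨_, proj_axialMap k q, hdr⟩

theorem image_ball (p : HypSpace) (r : ℝ) :
    proj lam tau '' Metric.ball p r = Metric.ball (proj lam tau p) r := by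
  ext y
  constructor
  · rintro ⟨q, hq, rfl⟩
    exact (dist_proj_le q p).trans_lt hq
  · intro hy
    rw [Metric.mem_ball, dist_comm] at hy
    obtain ⟨q, hq, hqr⟩ := exists_lift_dist_lt hy
    exact ⟨q, by rwa [Metric.mem_ball, dist_comm], hq⟩

theorem isOpenMap_proj : IsOpenMap (proj lam tau) := by
  intro U hU
  rw [Metric.isOpen_iff]
  rintro _ ⟨p, hp, rfl⟩
  obtain ⟨r, hr, hsub⟩ := Metric.isOpen_iff.1 hU p hp
  exact ⟨r, hr, by rw [← image_ball]; exact Set.image_mono hsub⟩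

theorem lam_le_dist_axialMap (hlam : 0 < lam) {k : ℤ} (hk : k ≠ 0) (p : HypSpace) :
    lam ≤ dist p (axialMap (k * ⟨lam, tau⟩) p) := by
  refine le_trans ?_ (abs_re_le_dist_axialMap _ p)
  have h : ((k : ℂ) * ⟨lam, tau⟩).re = k * lam := by simp
  rw [h, abs_mul, abs_of_pos hlam]
  have : (1 : ℝ) ≤ |(k : ℝ)| := by exact_mod_cast Int.one_le_abs hk
  nlinarith

/-- Points of this ball are less than lam / 2 apart, while nontrivial translates of b are at least
lam from b, hence more than lam / 2 from a. -/
theorem dist_proj_eq (hlam : 0 < lam) {q a b : HypSpace} (ha : a ∈ Metric.ball q (lam / 4))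
    (hb : b ∈ Metric.ball q (lam / 4)) :
    dist (proj lam tau a) (proj lam tau b) = dist a b := by
  refine le_antisymm (dist_proj_le a b) (le_dist_proj fun k => ?_)
  rcases eq_or_ne k 0 with rfl | hk
  · rw [Int.cast_zero, zero_mul, axialMap_zero]
  · have h1 := lam_le_dist_axialMap (tau := tau) hlam hk b
    have h2 := dist_triangle b a (axialMap (k * ⟨lam, tau⟩) b)
    have h3 := dist_triangle_right a b q
    rw [dist_comm b a] at h2
    rw [Metric.mem_ball] at ha hb
    linarith

theorem IsHyperbolicBall.two_mul_le_dist (hlam : 0 < lam) {p : HypSpace} {r : ℝ}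
    (h : IsHyperbolicBall (proj lam tau p) r) {k : ℤ} (hk : k ≠ 0) :
    2 * r ≤ dist p (axialMap (k * ⟨lam, tau⟩) p) := by
  obtain ⟨f, -, hbij, hloc⟩ := h
  have hne : Nonempty HypSpace := ⟨base⟩
  let g := Function.invFunOn f (Metric.ball base r)
  rw [← axialIsometry_zpow_apply]
  -- `G` is the inverse chart composed with the projection, so it is invariant under all deck
  -- transformations.
  refine two_mul_le_dist_of_locally_isometric (G := fun q => g (proj lam tau q)) ?_ ?_ ?_
  · intro q hq
    have hq' : proj lam tau q ∈ Metric.ball (proj lam tau p) r := by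
      rw [← image_ball]
      exact ⟨q, hq, rfl⟩
    obtain ⟨b, hb, hbq⟩ := hbij.surjOn hq'
    obtain ⟨U, -, hbU, hUsub, hfU, hiso⟩ := hloc b hb
    obtain ⟨δ, hδ, hδU⟩ := Metric.isOpen_iff.1 (hfU.preimage (continuous_proj (tau := tau))) q
      ⟨b, hbU, hbq⟩
    refine ⟨min δ (lam / 4), lt_min hδ (by positivity), fun a ha a' ha' => ?_⟩
    obtain ⟨u, hu, hua⟩ := hδU (Metric.ball_subset_ball (min_le_left _ _) ha)
    obtain ⟨u', hu', hua'⟩ := hδU (Metric.ball_subset_ball (min_le_left _ _) ha')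
    rw [← dist_proj_eq (tau := tau) hlam (Metric.ball_subset_ball (min_le_right _ _) ha)
      (Metric.ball_subset_ball (min_le_right _ _) ha'), ← hua, ← hua', hiso u hu u' hu']
    congr 1
    · exact hbij.injOn.leftInvOn_invFunOn (hUsub hu)
    · exact hbij.injOn.leftInvOn_invFunOn (hUsub hu')
  · intro q hq
    rw [axialIsometry_zpow_apply] at hq
    have := lam_le_dist_axialMap (tau := tau) hlam hk q
    rw [hq, dist_self] at this
    linarith
  · intro q
    rw [axialIsometry_zpow_apply, proj_axialMap]

/-- Two points of the r-ball in one orbit would give a displacement of p below 2r, so the projection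
is injective there and serves as the chart. -/
theorem isHyperbolicBall_of_two_mul_le_dist (hlam : 0 < lam) {p : HypSpace} {r : ℝ}
    (h : ∀ k : ℤ, k ≠ 0 → 2 * r ≤ dist p (axialMap (k * ⟨lam, tau⟩) p)) :
    IsHyperbolicBall (proj lam tau p) r := by
  have himg : ∀ (q : HypSpace) (s : ℝ), fromBase p '' Metric.ball q s =
      Metric.ball (fromBase p q) s := fun q s => (fromBase p).image_ball q s
  have hinj : Set.InjOn (proj lam tau) (Metric.ball p r) := by
    intro a ha b hb hab
    obtain ⟨k, rfl⟩ := proj_eq_proj_iff.1 hab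
    rcases eq_or_ne k 0 with rfl | hk
    · rw [Int.cast_zero, zero_mul, axialMap_zero]
    · have h1 := h k hk
      have h2 := dist_triangle p (axialMap (k * ⟨lam, tau⟩) a) (axialMap (k * ⟨lam, tau⟩) p)
      rw [axialMap_dist] at h2
      rw [Metric.mem_ball] at ha
      rw [Metric.mem_ball, dist_comm] at hb
      linarith
  refine ⟨fun q => proj lam tau (fromBase p q), by dsimp only; rw [fromBase_base], ⟨?_, ?_, ?_⟩, ?_⟩
  · intro q hq
    rw [← image_ball]
    refine ⟨_, ?_, rfl⟩
    rw [← fromBase_base p, ← himg, fromBase_base]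
    exact ⟨q, hq, rfl⟩
  · intro a ha b hb hab
    have hmem : ∀ a ∈ Metric.ball base r, fromBase p a ∈ Metric.ball p r := by
      intro a ha
      have : fromBase p a ∈ Metric.ball (fromBase p base) r := by
        rw [← himg]
        exact ⟨a, ha, rfl⟩
      rwa [fromBase_base] at this
    exact (fromBase p).injective (hinj (hmem a ha) (hmem b hb) hab)
  · intro y hy
    rw [← image_ball] at hy
    obtain ⟨q, hq, rfl⟩ := hy
    have : q ∈ fromBase p '' Metric.ball base r := by
      rwa [himg, fromBase_base]
    obtain ⟨a, ha, rfl⟩ := this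
    exact ⟨a, ha, rfl⟩
  · intro q hq
    refine ⟨Metric.ball q (lam / 4) ∩ Metric.ball base r,
      Metric.isOpen_ball.inter Metric.isOpen_ball, ⟨Metric.mem_ball_self (by positivity), hq⟩,
      Set.inter_subset_right, ?_, ?_⟩
    · have := isOpenMap_proj (lam := lam) (tau := tau) _ ((fromBase p).toHomeomorph.isOpenMap _
        ((Metric.isOpen_ball (x := q) (ε := lam / 4)).inter (Metric.isOpen_ball (x := base) (ε := r))))
      rwa [Set.image_image] at this
    · intro a ha b hb
      rw [← (fromBase p).dist_eq a b]
      exact dist_proj_eq (q := fromBase p q) hlam (by rw [← himg]; exact ⟨a, ha.1, rfl⟩)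
        (by rw [← himg]; exact ⟨b, hb.1, rfl⟩)

theorem injrad_proj_le (hlam : 0 < lam) (p : HypSpace) {k : ℤ} (hk : k ≠ 0) :
    injrad (proj lam tau p) ≤ dist p (axialMap (k * ⟨lam, tau⟩) p) / 2 := by
  -- The bound is nonnegative, so the value 0 of `sSup ∅` needs no separate treatment.
  refine Real.sSup_le ?_ (by positivity)
  rintro r ⟨-, hr⟩
  have := hr.two_mul_le_dist hlam hk
  linarith

theorem le_injrad_proj (hlam : 0 < lam) {p : HypSpace} {r : ℝ} (hr : 0 < r)
    (h : ∀ k : ℤ, k ≠ 0 → 2 * r ≤ dist p (axialMap (k * ⟨lam, tau⟩) p)) :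
    r ≤ injrad (proj lam tau p) := by
  refine le_csSup ⟨dist p (axialMap ((1 : ℤ) * ⟨lam, tau⟩) p) / 2, ?_⟩
    ⟨hr, isHyperbolicBall_of_two_mul_le_dist hlam h⟩
  rintro s ⟨-, hs⟩
  exact (le_div_iff₀' two_pos).2 (hs.two_mul_le_dist hlam one_ne_zero)

/-- The nearest axis point has height s = √(‖z‖² + t²), by (s − t')² ≥ 0, and the deck group
preserves the axis. So ‖z‖ / t is the sinh of the distance to the core. -/
theorem cosh_infDist_core (p : HypSpace) :
    Real.cosh (Metric.infDist (proj lam tau p) (core lam tau)) = √(1 + (‖p.z‖ / p.t) ^ 2) := by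
  have hp := p.t_pos
  rw [← Real.cosh_arsinh]
  congr 1
  have hcore : (core lam tau).Nonempty := ⟨_, base, rfl, rfl⟩
  set R := Real.arsinh (‖p.z‖ / p.t) with hR
  have hR0 : 0 ≤ R := Real.arsinh_nonneg_iff.2 (by positivity)
  have hcosh : Real.cosh R = √(1 + (‖p.z‖ / p.t) ^ 2) := Real.cosh_arsinh _
  set s := √(‖p.z‖ ^ 2 + p.t ^ 2) with hs
  have hs0 : 0 < s := Real.sqrt_pos.2 (by positivity)
  have hs2 : s ^ 2 = ‖p.z‖ ^ 2 + p.t ^ 2 := Real.sq_sqrt (by positivity)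
  have hcosh' : Real.cosh R = s / p.t := by
    rw [hcosh, Real.sqrt_eq_iff_eq_sq (by positivity) (by positivity), div_pow, div_pow, hs2]
    field_simp
    ring
  have hdist : ∀ (q : HypSpace), q ∈ axis →
      Real.cosh (dist p q) = (s ^ 2 + q.t ^ 2) / (2 * p.t * q.t) := by
    intro q hq
    have hq' := q.t_pos
    rw [cosh_dist, show q.z = 0 from hq, sub_zero, hs2]
    field_simp
    ring
  apply le_antisymm
  · have hmem : (⟨0, s, hs0⟩ : HypSpace) ∈ axis := rfl
    refine (Metric.infDist_le_dist_of_mem (Set.mem_image_of_mem _ hmem)).trans ((dist_proj_le _ _).trans ?_)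
    have h := hdist _ hmem
    dsimp only at h
    rw [show (s ^ 2 + s ^ 2) / (2 * p.t * s) = s / p.t by field_simp; ring, ← hcosh'] at h
    have h' := Real.cosh_le_cosh.1 h.le
    rwa [abs_of_nonneg dist_nonneg, abs_of_nonneg hR0] at h'
  · rw [Metric.le_infDist hcore]
    rintro _ ⟨q, hq, rfl⟩
    refine le_dist_proj fun k => ?_
    have hmem : axialMap (k * ⟨lam, tau⟩) q ∈ axis := by
      show Complex.exp _ * q.z = 0
      rw [show q.z = 0 from hq, mul_zero]
    set q' := axialMap (k * ⟨lam, tau⟩) q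
    have hq' := q'.t_pos
    rw [← abs_of_nonneg hR0, ← abs_of_nonneg (dist_nonneg (x := p) (y := q')),
      ← Real.cosh_le_cosh, hdist q' hmem, hcosh', div_le_div_iff₀ hp (by positivity)]
    nlinarith [mul_nonneg hp.le (sq_nonneg (s - q'.t))]

end SolidTorus

/-! ### Elementary estimates -/

theorem Real.cosh_sub_one (x : ℝ) : Real.cosh x - 1 = 2 * Real.sinh (x / 2) ^ 2 := by
  have h : x = 2 * (x / 2) := by ring
  conv_lhs => rw [h, Real.cosh_two_mul, Real.cosh_sq']
  ring

theorem Real.mul_sinh_lt_mul_sinh {x y : ℝ} (hx : 0 < x) (hxy : x < y) :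
    y * Real.sinh x < x * Real.sinh y := by
  have hconv : StrictConvexOn ℝ (Set.Ici 0) Real.sinh := by
    refine strictConvexOn_of_deriv2_pos (convex_Ici 0) Real.continuous_sinh.continuousOn ?_
    intro z hz
    rw [interior_Ici] at hz
    simpa using Real.sinh_pos_iff.2 hz
  have h := hconv.secant_strict_mono (a := 0) (x := x) (y := y) Set.self_mem_Ici hx.le
    (hx.trans hxy).le hx.ne' (hx.trans hxy).ne' hxy
  rw [Real.sinh_zero, sub_zero, sub_zero, sub_zero, sub_zero,
    div_lt_div_iff₀ hx (hx.trans hxy)] at h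
  linarith

theorem Real.sinh_lt_mul {x : ℝ} (hx : 0 < x) (hx' : x ≤ 0.15) : Real.sinh x < 1.004 * x := by
  have h1 := Real.exp_bound (x := x) (by rw [abs_of_pos hx]; linarith) (n := 4) (by norm_num)
  have h2 := Real.exp_bound (x := -x) (by rw [abs_neg, abs_of_pos hx]; linarith) (n := 4)
    (by norm_num)
  rw [abs_neg] at h2
  rw [abs_of_pos hx] at h1 h2
  simp only [Finset.sum_range_succ, Finset.sum_range_zero, Nat.factorial] at h1 h2
  norm_num at h1 h2
  have h1' := (abs_le.1 h1).2
  have h2' := (abs_le.1 h2).1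
  rw [Real.sinh_eq]
  -- With x ≤ 0.15, the bound x + x³/6 + 5x⁴/96 is at most about 1.00393 x.
  have hx2 : x ^ 2 ≤ 0.0225 := by nlinarith
  have hx3 : x ^ 3 ≤ 0.0225 * x := by nlinarith
  have hx4 : x ^ 4 ≤ 0.003375 * x := by nlinarith [mul_pos hx hx]
  nlinarith

/-- The root equals sinh(ε/2)/sinh(δ/2). Increasing secant slopes of sinh give the lower bound;
sinh(ε/2) < 1.004 ε/2 and sinh(δ/2) ≥ δ/2 give the upper one. -/
theorem Real.sqrt_cosh_sub_one_div_mem {δ ε : ℝ} (hδ : 0 < δ) (hδε : δ < ε) (hε : ε ≤ 0.3) :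
    √((Real.cosh ε - 1) / (Real.cosh δ - 1)) ∈ Set.Ioo (ε / δ) (1.004 * (ε / δ)) := by
  have hδ' := Real.sinh_pos_iff.2 (half_pos hδ)
  have hε0 := hδ.trans hδε
  have hε' := Real.sinh_pos_iff.2 (half_pos hε0)
  have e : √((Real.cosh ε - 1) / (Real.cosh δ - 1)) = Real.sinh (ε / 2) / Real.sinh (δ / 2) := by
    rw [Real.cosh_sub_one, Real.cosh_sub_one, mul_div_mul_left _ _ two_ne_zero, ← div_pow,
      Real.sqrt_sq (by positivity)]
  rw [e]
  constructor
  · rw [div_lt_div_iff₀ hδ hδ']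
    have := Real.mul_sinh_lt_mul_sinh (half_pos hδ) (by linarith : δ / 2 < ε / 2)
    linarith
  · have h1 := Real.sinh_lt_mul (half_pos hε0) (by linarith)
    have h2 : δ / 2 ≤ Real.sinh (δ / 2) := Real.self_le_sinh_iff.2 (by positivity)
    rw [div_lt_iff₀ hδ']
    calc Real.sinh (ε / 2) < 1.004 * (ε / 2) := h1
      _ = 1.004 * (ε / δ) * (δ / 2) := by field_simp
      _ ≤ _ := by gcongr

theorem Real.sq_mul_cosh_sub_one_le {c x : ℝ} (hc : 1 < c) (hx : 0 < x) :
    c ^ 2 * (Real.cosh x - 1) ≤ Real.cosh (c * x) - 1 := by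
  have hlt : x / 2 < c * x / 2 := by nlinarith
  have h := Real.mul_sinh_lt_mul_sinh (half_pos hx) hlt
  have h' : c * Real.sinh (x / 2) ≤ Real.sinh (c * x / 2) := by
    have : x / 2 * (c * Real.sinh (x / 2)) ≤ x / 2 * Real.sinh (c * x / 2) := by linarith
    exact le_of_mul_le_mul_left this (half_pos hx)
  have h0 := Real.sinh_pos_iff.2 (half_pos hx)
  rw [Real.cosh_sub_one, Real.cosh_sub_one]
  have := pow_le_pow_left₀ (by positivity) h' 2
  linarith

theorem Real.cosh_sub_one_le {x : ℝ} (hx : x ^ 2 ≤ 2) : Real.cosh x - 1 ≤ x ^ 2 / 2 + x ^ 4 / 4 := by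
  have h := Real.cosh_le_exp_half_sq x
  have h2 := Real.abs_exp_sub_one_sub_id_le (x := x ^ 2 / 2)
    (by rw [abs_of_nonneg (by positivity)]; linarith)
  have h3 := (abs_le.1 h2).2
  nlinarith

theorem Real.cos_two_pi_mul_div_le {n : ℕ} (hn : 2 ≤ n) {k : ℤ} (hk : ¬ (n : ℤ) ∣ k) :
    Real.cos (k * (2 * Real.pi / n)) ≤ Real.cos (2 * Real.pi / n) := by
  have hn0 : (0 : ℝ) < n := by exact_mod_cast (by omega : 0 < n)
  have hn0' : (n : ℤ) ≠ 0 := by omega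
  set r := k % n with hr
  have hr0 : 0 ≤ r := Int.emod_nonneg _ hn0'
  have hr1 : r < n := Int.emod_lt_of_pos _ (by omega)
  have hr2 : r ≠ 0 := fun h => hk (Int.dvd_of_emod_eq_zero h)
  have hkr : (k : ℝ) = r + n * (k / n : ℤ) := by
    exact_mod_cast (Int.emod_add_mul_ediv k n).symm
  have e : Real.cos (k * (2 * Real.pi / n)) = Real.cos (r * (2 * Real.pi / n)) := by
    rw [hkr, ← Real.cos_add_int_mul_two_pi (r * (2 * Real.pi / n)) (k / n)]
    congr 1
    field_simp
  rw [e]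
  have hπ := Real.pi_pos
  have key : ∀ s : ℤ, 1 ≤ s → 2 * s ≤ n → Real.cos (s * (2 * Real.pi / n)) ≤ Real.cos (2 * Real.pi / n) := by
    intro s hs hsn
    have hs' : (1 : ℝ) ≤ s := by exact_mod_cast hs
    have hsn' : (2 : ℝ) * s ≤ n := by exact_mod_cast hsn
    refine Real.cos_le_cos_of_nonneg_of_le_pi (by positivity) ?_ ?_
    · rw [← mul_div_assoc, div_le_iff₀ hn0]
      nlinarith
    · exact le_mul_of_one_le_left (by positivity) hs'
  rcases le_total (2 * r) n with h | h
  · exact key r (by omega) h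
  -- Past half a turn, reflect r to n − r.
  · rw [← Real.cos_two_pi_sub, show 2 * Real.pi - r * (2 * Real.pi / n) = ((n - r : ℤ) : ℝ) * (2 * Real.pi / n) by
      push_cast; field_simp]
    exact key _ (by omega) (by omega)

theorem Real.one_sub_cos_ge {δ : ℝ} (hδ : 0 < δ) (hδ' : δ ≤ 1 / 5) :
    33.4 * (δ ^ 2 / 2) ≤ 1 - Real.cos (2 * Real.pi * δ) := by
  have hπ1 := Real.pi_gt_d2
  have hπ2 := Real.pi_lt_d2
  set y := Real.pi * δ with hy
  have hy0 : 0 < y := by positivity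
  have hy1 : y ≤ 0.63 := by nlinarith
  have hy2 : 3.14 * δ ≤ y := by nlinarith
  have hsin := (abs_le.1 (Real.sin_bound (x := y) (by rw [abs_of_pos hy0]; linarith))).1
  rw [abs_of_pos hy0] at hsin
  have hys : y ^ 2 ≤ 0.3969 := by nlinarith
  have hyc : y ^ 4 ≤ 0.250047 * y := by nlinarith [mul_pos hy0 hy0]
  -- The constants chain as 3.14 · 0.9207 > 2.89 and 2 · 2.89² > 33.4 / 2.
  have hlow : 0.9207 * y ≤ Real.sin y := by nlinarith
  have hlow' : 2.89 * δ ≤ Real.sin y := by linarith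
  have e : 1 - Real.cos (2 * Real.pi * δ) = 2 * Real.sin y ^ 2 := by
    rw [show 2 * Real.pi * δ = 2 * y by rw [hy]; ring, Real.cos_two_mul, Real.cos_sq']
    ring
  rw [e]
  nlinarith [pow_le_pow_left₀ (by positivity) hlow' 2]

/-! ### Comparing the powers -/

/-- From the distance at which the `n`-th power of the isometry of complex length
`1 / n ^ 2 + 2 π i / n` displaces points by `1.016 / n` on, no other power displaces points less. -/
theorem displacement_pow_le {n : ℕ} (hn : 4 ≤ n) {a : ℝ} (ha : 0 ≤ a)
    (h : Real.cosh (1.016 / n) - 1 ≤ (1 + a) * (Real.cosh (1 / n) - 1)) {k : ℤ} (hk : k ≠ 0) :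
    (1 + a) * (Real.cosh (1 / n) - 1) + 1 ≤
      a * (Real.cosh (k * (1 / (n : ℝ) ^ 2)) - Real.cos (k * (2 * Real.pi / n))) +
        Real.cosh (k * (1 / (n : ℝ) ^ 2)) := by
  have hn0 : (0 : ℝ) < n := by exact_mod_cast (by omega : 0 < n)
  by_cases hdvd : (n : ℤ) ∣ k
  · have hcos := Real.cos_le_one (k * (2 * Real.pi / n))
    have hcosh : Real.cosh (1 / n) ≤ Real.cosh (k * (1 / (n : ℝ) ^ 2)) := by
      rw [Real.cosh_le_cosh, abs_mul, abs_of_pos (by positivity : 0 < 1 / (n : ℝ)),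
        abs_of_pos (by positivity : 0 < 1 / (n : ℝ) ^ 2)]
      have : (n : ℝ) ≤ |(k : ℝ)| := by
        exact_mod_cast Int.le_of_dvd (abs_pos.2 hk) ((dvd_abs _ _).2 hdvd)
      calc 1 / (n : ℝ) = n * (1 / (n : ℝ) ^ 2) := by field_simp
        _ ≤ _ := by gcongr
    nlinarith
  · have hcos := Real.cos_two_pi_mul_div_le (by omega : 2 ≤ n) hdvd
    have hcosh : Real.cosh (1 / (n : ℝ) ^ 2) ≤ Real.cosh (k * (1 / (n : ℝ) ^ 2)) := by
      rw [Real.cosh_le_cosh, abs_mul]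
      have : (1 : ℝ) ≤ |(k : ℝ)| := by exact_mod_cast Int.one_le_abs hk
      exact le_mul_of_one_le_left (abs_nonneg _) this
    have hA : 0 < Real.cosh (1 / (n : ℝ)) - 1 := by
      have := Real.one_lt_cosh.2 (one_div_pos.2 hn0).ne'
      linarith
    -- 0.032256 = 1.016² − 1.
    have ha' : 0.032256 ≤ a := by
      have h1 := Real.sq_mul_cosh_sub_one_le (by norm_num : (1 : ℝ) < 1.016) (one_div_pos.2 hn0)
      rw [mul_one_div] at h1
      have := le_of_mul_le_mul_right (h1.trans h) hA
      norm_num at this ⊢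
      linarith
    -- For n = 4 the margin is so thin that the translation by 1/16 must be counted besides the
    -- quarter turn. For n ≥ 5 the rotation alone suffices: 1.02 (1 + a) ≤ 33.4 a holds from a ≈
    -- 0.0315 on.
    rcases hn.eq_or_lt with rfl | hn5
    · have h1 := Real.cosh_sub_one_le (x := 1 / 4) (by norm_num)
      have h2 : 1 + (1 / 16 : ℝ) ^ 2 / 2 ≤ Real.cosh (1 / 16) := by
        have h3 := Real.cosh_sub_one (1 / 16)
        have h4 : (1 / 16 / 2 : ℝ) ≤ Real.sinh (1 / 16 / 2) :=
          Real.self_le_sinh_iff.2 (by norm_num)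
        nlinarith
      have h5 : Real.cos (2 * Real.pi / (4 : ℕ)) = 0 := by
        rw [← Real.cos_pi_div_two]
        congr 1
        push_cast
        ring
      rw [h5] at hcos
      norm_num only at h1
      rw [show 1 / ((4 : ℕ) : ℝ) ^ 2 = 1 / 16 by norm_num] at hcosh ⊢
      rw [show 1 / ((4 : ℕ) : ℝ) = 1 / 4 by norm_num]
      have h6 : a * (Real.cosh (1 / 16) - 0) ≤
          a * (Real.cosh (k * (1 / 16)) - Real.cos (k * (2 * Real.pi / (4 : ℕ)))) := by
        gcongr
      have h7 : (1 + a) * (Real.cosh (1 / 4) - 1) ≤ (1 + a) * (33 / 1024) := by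
        gcongr
      nlinarith
    · have hn5' : (5 : ℝ) ≤ n := by exact_mod_cast hn5
      have hδ : 1 / (n : ℝ) ≤ 1 / 5 := by gcongr
      have hδ0 : 0 < 1 / (n : ℝ) := by positivity
      have h1 := Real.one_sub_cos_ge hδ0 hδ
      rw [mul_one_div] at h1
      have hone := Real.one_le_cosh (k * (1 / (n : ℝ) ^ 2))
      set δ := 1 / (n : ℝ)
      have hδ2 : δ ^ 2 ≤ 1 / 25 := by nlinarith
      have h2 := Real.cosh_sub_one_le (x := δ) (by linarith)
      have h3 : Real.cosh δ - 1 ≤ 1.02 * (δ ^ 2 / 2) := by nlinarith [sq_nonneg δ]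
      have hS : 0 ≤ δ ^ 2 / 2 := by positivity
      have h4 : a * (33.4 * (δ ^ 2 / 2)) ≤ a * (1 - Real.cos (2 * Real.pi / n)) := by gcongr
      have h5 : (1 + a) * (Real.cosh δ - 1) ≤ (1 + a) * (1.02 * (δ ^ 2 / 2)) := by gcongr
      have h6 : (1 + a) * (1.02 * (δ ^ 2 / 2)) ≤ a * (33.4 * (δ ^ 2 / 2)) := by
        nlinarith [mul_le_mul_of_nonneg_right ha' hS]
      have h7 : a * (1 - Real.cos (2 * Real.pi / n)) ≤
          a * (Real.cosh (k * (1 / (n : ℝ) ^ 2)) - Real.cos (k * (2 * Real.pi / n))) := by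
        gcongr
      linarith

/-! ### The thin part as a tube -/

namespace SolidTorus

open HypSpace

variable {lam tau : ℝ}

theorem cosh_dist_axialMap_natCast {n : ℕ} (hn : n ≠ 0) (p : HypSpace) :
    Real.cosh (dist p (axialMap ((n : ℤ) * ⟨1 / (n : ℝ) ^ 2, 2 * Real.pi / n⟩) p)) =
      (1 + (‖p.z‖ / p.t) ^ 2) * (Real.cosh (1 / n) - 1) + 1 := by
  have hn0 : (n : ℝ) ≠ 0 := by exact_mod_cast hn
  have hre : (((n : ℤ) : ℂ) * ⟨1 / (n : ℝ) ^ 2, 2 * Real.pi / n⟩).re = 1 / n := by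
    simp
    field_simp
  have him : (((n : ℤ) : ℂ) * ⟨1 / (n : ℝ) ^ 2, 2 * Real.pi / n⟩).im = 2 * Real.pi := by
    simp
    field_simp
  rw [cosh_dist_axialMap, hre, him, Real.cos_two_pi]
  ring

theorem dist_axialMap_natCast_le {n : ℕ} (hn : 4 ≤ n) {p : HypSpace}
    (hp : 1.016 / n ≤ dist p (axialMap ((n : ℤ) * ⟨1 / (n : ℝ) ^ 2, 2 * Real.pi / n⟩) p)) {k : ℤ}
    (hk : k ≠ 0) :
    dist p (axialMap ((n : ℤ) * ⟨1 / (n : ℝ) ^ 2, 2 * Real.pi / n⟩) p) ≤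
      dist p (axialMap (k * ⟨1 / (n : ℝ) ^ 2, 2 * Real.pi / n⟩) p) := by
  have h1 := cosh_dist_axialMap_natCast (by omega : n ≠ 0) p
  have hre : ((k : ℂ) * ⟨1 / (n : ℝ) ^ 2, 2 * Real.pi / n⟩).re = k * (1 / (n : ℝ) ^ 2) := by simp
  have him : ((k : ℂ) * ⟨1 / (n : ℝ) ^ 2, 2 * Real.pi / n⟩).im = k * (2 * Real.pi / n) := by simp
  have h2 := cosh_dist_axialMap ((k : ℂ) * ⟨1 / (n : ℝ) ^ 2, 2 * Real.pi / n⟩) p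
  rw [hre, him] at h2
  have h3 : Real.cosh (1.016 / n) ≤
      Real.cosh (dist p (axialMap ((n : ℤ) * ⟨1 / (n : ℝ) ^ 2, 2 * Real.pi / n⟩) p)) := by
    rw [Real.cosh_le_cosh, abs_of_nonneg (by positivity), abs_of_nonneg dist_nonneg]
    exact hp
  have h4 := displacement_pow_le hn (sq_nonneg (‖p.z‖ / p.t)) (by linarith) hk
  rw [← h1, ← h2, Real.cosh_le_cosh, abs_of_nonneg dist_nonneg, abs_of_nonneg dist_nonneg] at h4
  exact h4

/-- If φ^n moves p by more than ε ≥ 1.016/n, it is the least displacing power and the injectivity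
radius exceeds ε/2. Otherwise φ^n alone bounds that radius by ε/2, whether or not another power is
shorter. -/
theorem mem_thinPart_iff {n : ℕ} (hn : 4 ≤ n) {ε : ℝ} (hε : 1.016 / n ≤ ε) (p : HypSpace) :
    proj (1 / (n : ℝ) ^ 2) (2 * Real.pi / n) p ∈ thinPart (1 / (n : ℝ) ^ 2) (2 * Real.pi / n) ε ↔
      (1 + (‖p.z‖ / p.t) ^ 2) * (Real.cosh (1 / n) - 1) ≤ Real.cosh ε - 1 := by
  have hn0 : (0 : ℝ) < n := by exact_mod_cast (by omega : 0 < n)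
  have hlam : 0 < 1 / (n : ℝ) ^ 2 := by positivity
  have hε0 : 0 < ε := lt_of_lt_of_le (by positivity) hε
  have hD := cosh_dist_axialMap_natCast (by omega : n ≠ 0) p
  have hiff : dist p (axialMap ((n : ℤ) * ⟨1 / (n : ℝ) ^ 2, 2 * Real.pi / n⟩) p) ≤ ε ↔
      (1 + (‖p.z‖ / p.t) ^ 2) * (Real.cosh (1 / n) - 1) ≤ Real.cosh ε - 1 := by
    rw [← abs_of_nonneg (dist_nonneg (x := p)), ← abs_of_pos hε0, ← Real.cosh_le_cosh, hD,
      abs_of_pos hε0]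
    constructor <;> intro h <;> linarith
  rw [← hiff]
  have hn' : (n : ℤ) ≠ 0 := by omega
  constructor
  · intro h
    by_contra! hlt
    have := le_injrad_proj hlam (p := p) (half_pos (hε0.trans hlt)) fun k hk => by
      rw [mul_div_cancel₀ _ two_ne_zero]
      exact dist_axialMap_natCast_le hn (hε.trans hlt.le) hk
    have h' : injrad (proj (1 / (n : ℝ) ^ 2) (2 * Real.pi / n) p) ≤ ε / 2 := h
    linarith
  · intro h
    have := injrad_proj_le (tau := 2 * Real.pi / n) hlam p hn'
    show injrad _ ≤ ε / 2
    linarith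

theorem equidistantTorus_nonempty {r : ℝ} (hr : 0 ≤ r) :
    (equidistantTorus lam tau r).Nonempty := by
  refine ⟨proj lam tau ⟨(Real.sinh r : ℝ), 1, one_pos⟩, ?_⟩
  have h := cosh_infDist_core (lam := lam) (tau := tau) ⟨(Real.sinh r : ℝ), 1, one_pos⟩
  dsimp only at h
  rw [div_one, Complex.norm_real, Real.norm_eq_abs, sq_abs, ← Real.cosh_sq',
    Real.sqrt_sq (Real.cosh_pos r).le] at h
  have h' := congrArg Real.arcosh h
  rwa [Real.arcosh_cosh Metric.infDist_nonneg, Real.arcosh_cosh hr] at h'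

/-- A point at distance r > 0 is off the core, and lowering its height slightly moves it farther
away, so it is not interior. -/
theorem frontier_setOf_infDist_core_le {r : ℝ} (hr : 0 < r) :
    frontier {x | Metric.infDist x (core lam tau) ≤ r} = equidistantTorus lam tau r := by
  refine (frontier_le_subset_eq (Metric.continuous_infDist_pt _) continuous_const).antisymm ?_
  intro x (hx : Metric.infDist x (core lam tau) = r)
  refine ⟨subset_closure hx.le, fun hint => ?_⟩
  obtain ⟨p, rfl⟩ := proj_surjective x
  have hp := p.t_pos
  have hcore := cosh_infDist_core (lam := lam) (tau := tau) p
  have hz : 0 < ‖p.z‖ := by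
    rw [norm_pos_iff]
    intro h0
    rw [h0, norm_zero, zero_div, hx] at hcore
    have := Real.one_lt_cosh.2 hr.ne'
    norm_num at hcore
    linarith
  obtain ⟨δ, hδ, hball⟩ := Metric.isOpen_iff.1
    (isOpen_interior.preimage (continuous_proj (lam := lam) (tau := tau))) p hint
  have hcδ := Real.one_lt_cosh.2 hδ.ne'
  -- Dividing the height by s moves the point by d with cosh d − 1 = (s − 1)²/(2s), which is less
  -- than s − 1 ≤ cosh δ − 1.
  set s := 1 + min 1 (Real.cosh δ - 1) with hs
  have hm0 : 0 < min 1 (Real.cosh δ - 1) := lt_min one_pos (by linarith)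
  have hm1 := min_le_left 1 (Real.cosh δ - 1)
  have hm2 := min_le_right 1 (Real.cosh δ - 1)
  have hs1 : 1 < s := by linarith
  have hs0 : 0 < s := by linarith
  let q : HypSpace := ⟨p.z, p.t / s, by positivity⟩
  have hq : q ∈ Metric.ball p δ := by
    have h : Real.cosh (dist q p) < Real.cosh δ := by
      rw [cosh_dist]
      have e : (‖q.z - p.z‖ ^ 2 + (q.t - p.t) ^ 2) / (2 * q.t * p.t) = (s - 1) ^ 2 / (2 * s) := by
        simp only [q, sub_self, norm_zero]
        field_simp
        ring
      have : (s - 1) ^ 2 / (2 * s) < Real.cosh δ - 1 := by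
        rw [div_lt_iff₀ (by positivity)]
        nlinarith
      rw [e]
      linarith
    rw [Real.cosh_lt_cosh, abs_of_nonneg dist_nonneg, abs_of_pos hδ] at h
    exact h
  have hmem : proj lam tau q ∈ {x | Metric.infDist x (core lam tau) ≤ r} :=
    interior_subset (hball hq)
  have hle : Metric.infDist (proj lam tau q) (core lam tau) ≤ r := hmem
  have hlt : Real.cosh (Metric.infDist (proj lam tau p) (core lam tau)) <
      Real.cosh (Metric.infDist (proj lam tau q) (core lam tau)) := by
    rw [hcore, cosh_infDist_core]
    apply Real.sqrt_lt_sqrt (by positivity)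
    have : ‖p.z‖ / p.t < ‖q.z‖ / q.t := by
      simp only [q]
      gcongr
      exact div_lt_self hp hs1
    gcongr
  rw [Real.cosh_lt_cosh, abs_of_nonneg Metric.infDist_nonneg, abs_of_nonneg Metric.infDist_nonneg,
    hx] at hlt
  linarith

theorem thinPart_eq {n : ℕ} (hn : 4 ≤ n) {ε : ℝ} (hε : 1.016 / n ≤ ε) :
    thinPart (1 / (n : ℝ) ^ 2) (2 * Real.pi / n) ε =
      {x | Metric.infDist x (core (1 / (n : ℝ) ^ 2) (2 * Real.pi / n)) ≤
        Real.arcosh √((Real.cosh ε - 1) / (Real.cosh (1 / n) - 1))} := by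
  have hn0 : (0 : ℝ) < n := by exact_mod_cast (by omega : 0 < n)
  have hA : 0 < Real.cosh (1 / (n : ℝ)) - 1 := sub_pos.2 (Real.one_lt_cosh.2 (by positivity))
  have hC : 1 ≤ √((Real.cosh ε - 1) / (Real.cosh (1 / n) - 1)) := by
    rw [Real.one_le_sqrt, one_le_div hA, sub_le_sub_iff_right, Real.cosh_le_cosh,
      abs_of_pos (by positivity), abs_of_pos (lt_of_lt_of_le (by positivity) hε)]
    refine le_trans ?_ hε
    gcongr
    norm_num
  ext x
  obtain ⟨p, rfl⟩ := proj_surjective x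
  rw [mem_thinPart_iff hn hε, Set.mem_ofPred_eq,
    ← abs_of_nonneg (Metric.infDist_nonneg (x := proj (1 / (n : ℝ) ^ 2) (2 * Real.pi / n) p)),
    ← abs_of_nonneg (Real.arcosh_nonneg hC), ← Real.cosh_le_cosh, cosh_infDist_core,
    Real.cosh_arcosh hC, Real.sqrt_le_sqrt_iff (Real.sqrt_pos.1 (one_pos.trans_le hC)).le, le_div_iff₀ hA]

end SolidTorus

theorem proposition4p1 (n : ℕ) (hn : 4 ≤ n) (lam tau : ℝ)
    (hlam : lam = 1 / (n : ℝ) ^ 2) (htau : tau = 2 * Real.pi / (n : ℝ))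
    (ε : ℝ) (hε₁ : 1.016 / (n : ℝ) ≤ ε) (hε₂ : ε ≤ 0.3) :
    (SolidTorus.openThinPart lam tau ε).Nonempty ∧
    (frontier (SolidTorus.thinPart lam tau ε)).Nonempty ∧
    frontier (SolidTorus.thinPart lam tau ε) =
      SolidTorus.equidistantTorus lam tau (SolidTorus.tubeRadius lam tau ε) ∧
    Real.cosh (SolidTorus.tubeRadius lam tau ε) =
      √((Real.cosh ε - 1) / (Real.cosh (√lam) - 1)) ∧
    √((Real.cosh ε - 1) / (Real.cosh (√lam) - 1)) ∈
      Set.Ioo (ε / √lam) (1.004 * (ε / √lam)) := by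

  have hn0 : (0 : ℝ) < n := by exact_mod_cast (by omega : 0 < n)
  have hδε : 1 / (n : ℝ) < ε := by
    refine lt_of_lt_of_le ?_ hε₁
    gcongr
    norm_num
  have hδ0 : 0 < 1 / (n : ℝ) := by positivity
  have hsqrt : √lam = 1 / n := by
    rw [hlam, show 1 / (n : ℝ) ^ 2 = (1 / n) ^ 2 by ring, Real.sqrt_sq hδ0.le]
  have hmem := Real.sqrt_cosh_sub_one_div_mem hδ0 hδε hε₂
  -- Strictness makes the tube radius positive, as the frontier computation requires.
  have hC : 1 < √((Real.cosh ε - 1) / (Real.cosh (1 / n) - 1)) :=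
    ((one_lt_div hδ0).2 hδε).trans hmem.1
  have hr := Real.arcosh_pos hC
  have hfr : frontier (SolidTorus.thinPart lam tau ε) = SolidTorus.equidistantTorus lam tau
      (Real.arcosh √((Real.cosh ε - 1) / (Real.cosh (1 / n) - 1))) := by
    rw [hlam, htau, SolidTorus.thinPart_eq hn hε₁, SolidTorus.frontier_setOf_infDist_core_le hr]
  have hne := SolidTorus.equidistantTorus_nonempty (lam := lam) (tau := tau) hr.le
  have htube : SolidTorus.tubeRadius lam tau ε =
      Real.arcosh √((Real.cosh ε - 1) / (Real.cosh (1 / n) - 1)) := by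
    rw [SolidTorus.tubeRadius, hfr]
    -- The distance to the core is constant on the nonempty frontier, so the supremum is over a
    -- singleton.
    refine (congrArg sSup (Set.eq_singleton_iff_nonempty_unique_mem.2 ⟨hne.image _, ?_⟩)).trans
      (csSup_singleton _)
    rintro _ ⟨x, hx, rfl⟩
    exact hx
  rw [htube, hsqrt]
  -- The base point lies on the axis, where φ^n displaces by exactly 1/n < ε.
  refine ⟨⟨SolidTorus.proj lam tau HypSpace.base, ?_⟩, hfr ▸ hne, hfr,
    Real.cosh_arcosh hC.le, hmem⟩
  have hlam0 : 0 < lam := by rw [hlam]; positivity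
  have hinj := SolidTorus.injrad_proj_le (tau := tau) hlam0 HypSpace.base
    (by omega : (n : ℤ) ≠ 0)
  have hD := SolidTorus.cosh_dist_axialMap_natCast (by omega : n ≠ 0) HypSpace.base
  rw [← hlam, ← htau] at hD
  have hlt : Real.cosh (dist HypSpace.base
      (HypSpace.axialMap ((n : ℤ) * ⟨lam, tau⟩) HypSpace.base)) < Real.cosh ε := by
    rw [hD]
    simp only [HypSpace.base, norm_zero, zero_div]
    have := Real.cosh_lt_cosh.2 (by rwa [abs_of_pos hδ0, abs_of_pos (hδ0.trans hδε)] :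
      |1 / (n : ℝ)| < |ε|)
    linarith
  rw [Real.cosh_lt_cosh, abs_of_nonneg dist_nonneg, abs_of_pos (hδ0.trans hδε)] at hlt
  show ¬ ε / 2 ≤ _
  linarith
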